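/- A real process $X=(X_n)_{n\in\mathbb Z}$ is infinitely divisible (ID) if for every $n\ge 1$ it is equal in distribution to a sum of $n$ i.i.d. processes. A measure $Q$ on $\mathbb R^{\mathbb Z}$ is the Lévy measure of an ID process $X$ if $Q(\{0\})=0$, $\int (x_k^2\wedge 1)\,Q(dx)<\infty$ for all $k\in\mathbb Z$, and there are a symmetric positive semidefinite $\Gamma:\mathbb Z\times\mathbb Z\to\mathbb R$ (the Gaussian part) and $b\in\mathbb R^{\mathbb Z}$ (the drift) such that, for every finitely supported family of reals $(a_k)_{k\in\mathbb Z}$, $$\mathbb E\, e^{i\sum_k a_kX_k}=\exp\Big[i\sum_k a_kb_k-\tfrac12\sum_{j,k}a_ja_k\Gamma_{jk}+\int_{\mathbb R^{\mathbb Z}}\Big(e^{i\sum_k a_kx_k}-1-i\sum_k a_k\,c(x_k)\Big)Q(dx)\Big],$$ where $c(x)=\max(-1,\min(x,1))$. (By the Lévy–Khintchine theorem each ID process has exactly one Lévy measure.) $X$ is an IDp process if it is ID and this holds with $\Gamma=0$. Let $X$ be a stationary IDp process with Lévy measure $Q$. Call $X$ pure if, whenever $X_1$ and $X_2$ are independent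 stationary ID processes, with Lévy measures $Q_1$ and $Q_2$, such that $X_1+X_2$ has the same distribution as $X$, there is $\kappa\in[0,1]$ with $Q_1=\kappa Q$ and $Q_2=(1-\kappa)Q$. Proposition. $X$ is pure if and only if $Q$ is ergodic under the shift $S:(x_n)_{n}\mapsto(x_{n+1})_{n}$ of $\mathbb R^{\mathbb Z}$, that is, $Q$ is $S$-invariant and every Borel set $A$ with $S^{-1}A=A$ satisfies $Q(A)=0$ or $Q(A^c)=0$. -/

import Mathlib

open MeasureTheory ProbabilityTheory
open scoped NNReal ENNReal

noncomputable section

namespace IDProcess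

/-- The shift `S` on the path space `ℝ^ℤ`, `(S x)ₙ = xₙ₊₁`. -/
def shift (x : ℤ → ℝ) : ℤ → ℝ := fun n => x (n + 1)

/-- The distribution on `ℝ^ℤ` of a process `X` indexed by `ℤ`. -/
def law {Ω : Type*} [MeasurableSpace Ω] (X : ℤ → Ω → ℝ) (μ : Measure Ω) : Measure (ℤ → ℝ) :=
  μ.map (fun ω n => X n ω)

/-- A process with distribution `P` is (strictly) stationary: `P` is shift-invariant. -/
def IsStationary (P : Measure (ℤ → ℝ)) : Prop := MeasurePreserving shift P P

/-- A process with distribution `P` is infinitely divisible: for every `n ≥ 1`, it is equal in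
distribution to the sum of `n` independent and identically distributed processes. -/
def IsInfinitelyDivisible (P : Measure (ℤ → ℝ)) : Prop :=
  ∀ n : ℕ, 1 ≤ n → ∃ ν : Measure (ℤ → ℝ), IsProbabilityMeasure ν ∧
    P = (Measure.pi (fun _ : Fin n => ν)).map (fun y => ∑ i, y i)

/-- The truncation function: `-1` for `x < -1`, `x` for `-1 ≤ x ≤ 1`, and `1` for `x > 1`. -/
def trunc (x : ℝ) : ℝ := max (-1) (min x 1)

/-- The Lévy–Khintchine exponent at `a` of the triplet with Gaussian covariance `Γ`, drift `b` and
Lévy measure `Q`. -/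
def levyExponent (Γ : Matrix ℤ ℤ ℝ) (b : ℤ → ℝ) (Q : Measure (ℤ → ℝ)) (a : ℤ →₀ ℝ) : ℂ :=
  Complex.I * ((a.sum fun k r => r * b k : ℝ) : ℂ)
    - (((1 / 2 : ℝ) * a.sum fun j r => a.sum fun k s => r * Γ j k * s : ℝ) : ℂ)
    + ∫ x : ℤ → ℝ, (Complex.exp (Complex.I * ((a.sum fun k r => r * x k : ℝ) : ℂ)) - 1
        - Complex.I * ((a.sum fun k r => r * trunc (x k) : ℝ) : ℂ)) ∂Q

/-- A process with distribution `P` has the Lévy–Khintchine triplet `(Γ, b, Q)`: here `a` runs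
through all finitely supported families of coefficients, so that `∑ₖ aₖ Xₖ` runs through all finite
linear combinations of the process. The conditions on `Q` make the integrand in `levyExponent`
integrable and `Q` a σ-finite measure. -/
structure HasLevyTriplet (P : Measure (ℤ → ℝ)) (Γ : Matrix ℤ ℤ ℝ) (b : ℤ → ℝ)
    (Q : Measure (ℤ → ℝ)) : Prop where
  gaussian_posSemidef : Γ.PosSemidef
  zero_path : Q {0} = 0
  lintegral_lt_top : ∀ k : ℤ, ∫⁻ x : ℤ → ℝ, ENNReal.ofReal (min (x k ^ 2) 1) ∂Q < ∞
  charFun_eq : ∀ a : ℤ →₀ ℝ,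
    ∫ x : ℤ → ℝ, Complex.exp (Complex.I * ((a.sum fun k r => r * x k : ℝ) : ℂ)) ∂P =
      Complex.exp (levyExponent Γ b Q a)

/-- `Q` is the Lévy measure of an infinitely divisible process with distribution `P` (which may
have a Gaussian part and a drift). -/
def IsLevyMeasure (P Q : Measure (ℤ → ℝ)) : Prop :=
  IsInfinitelyDivisible P ∧ ∃ Γ b, HasLevyTriplet P Γ b Q

/-- A process with distribution `P` is infinitely divisible without Gaussian part (an IDp process),
and `Q` is its Lévy measure. -/
def IsIDpWithLevyMeasure (P Q : Measure (ℤ → ℝ)) : Prop :=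
  IsInfinitelyDivisible P ∧ ∃ b, HasLevyTriplet P 0 b Q

/-- A process with distribution `P` and Lévy measure `Q` is pure: whenever `X₁`, `X₂` are
independent stationary infinitely divisible processes such that `X₁ + X₂` has distribution `P`,
their Lévy measures are `c Q` and `(1 - c) Q` for some `c ∈ [0, 1]`. (Every pair of distributions
on `ℝ^ℤ` is realized by independent processes on some `Ω : Type`.) -/
def IsPure (P Q : Measure (ℤ → ℝ)) : Prop :=
  ∀ (Ω : Type) (_ : MeasurableSpace Ω) (μ : Measure Ω) (_ : IsProbabilityMeasure μ)
    (X₁ X₂ : ℤ → Ω → ℝ) (Q₁ Q₂ : Measure (ℤ → ℝ)),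
    (∀ n, Measurable (X₁ n)) → (∀ n, Measurable (X₂ n)) →
    IndepFun (fun ω n => X₁ n ω) (fun ω n => X₂ n ω) μ →
    IsStationary (law X₁ μ) → IsStationary (law X₂ μ) →
    IsLevyMeasure (law X₁ μ) Q₁ → IsLevyMeasure (law X₂ μ) Q₂ →
    law (X₁ + X₂) μ = P →
    ∃ c : ℝ≥0, c ≤ 1 ∧ Q₁ = c • Q ∧ Q₂ = (1 - c) • Q

end IDProcess

end

/-! Both directions rest on a dictionary between stationary IDp laws and shift-invariant pairs
(drift, Lévy measure), in which independent sums become sums of triplets.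

If `Q` is ergodic and `X₁ + X₂` has law `P`, uniqueness of the Lévy measure (`levyMeasure_unique`)
gives `Q = Q₁ + Q₂`, and stationarity makes `Q₁` shift-invariant
(`HasLevyTriplet.measurePreserving`). The density of `Q₁` with respect to `Q` is then invariant,
hence constant (`exists_eq_smul_of_ergodic`).

Conversely, an invariant set `A` splits `Q` into its restrictions to `A` and `Aᶜ`. Each is the Lévy
measure of a stationary process (`IsLevyMeasureCandidate.exists_hasLevyTriplet`), and the two
independent processes add up to `X` in law. Purity makes `Q.restrict A` a multiple of `Q`, so `A` or
`Aᶜ` is null.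

Uniqueness is obtained by taking second differences of the exponent, which turns it into the Fourier
transform of a finite measure; existence by compound Poisson approximation and Lévy's continuity
theorem. -/

noncomputable section

namespace IDProcess

open Filter Topology

/-! ### Characters and characteristic functions on the path space -/

/-- The pairing `∑ₖ aₖ xₖ` of a finitely supported family of coefficients with a path. -/
def pairing (a : ℤ →₀ ℝ) (x : ℤ → ℝ) : ℝ := a.sum fun k r => r * x k

lemma pairing_eq_sum (a : ℤ →₀ ℝ) (x : ℤ → ℝ) : pairing a x = ∑ k ∈ a.support, a k * x k := rfl

lemma pairing_eq_bilinear (a : ℤ →₀ ℝ) (x : ℤ → ℝ) :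
    pairing a x = Finsupp.bilinearCombination ℝ ℝ x a := by
  simp [pairing, Finsupp.bilinearCombination_apply, Finsupp.linearCombination_apply]

@[simp] lemma pairing_zero_left (x : ℤ → ℝ) : pairing 0 x = 0 := by simp [pairing]

@[simp] lemma pairing_zero_right (a : ℤ →₀ ℝ) : pairing a 0 = 0 := by simp [pairing]

@[simp] lemma pairing_single (k : ℤ) (t : ℝ) (x : ℤ → ℝ) :
    pairing (Finsupp.single k t) x = t * x k := by simp [pairing]

lemma pairing_add_left (a b : ℤ →₀ ℝ) (x : ℤ → ℝ) :
    pairing (a + b) x = pairing a x + pairing b x := by simp [pairing_eq_bilinear]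

lemma pairing_sub_left (a b : ℤ →₀ ℝ) (x : ℤ → ℝ) :
    pairing (a - b) x = pairing a x - pairing b x := by simp [pairing_eq_bilinear]

lemma pairing_smul_left (t : ℝ) (a : ℤ →₀ ℝ) (x : ℤ → ℝ) :
    pairing (t • a) x = t * pairing a x := by simp [pairing_eq_bilinear]

lemma pairing_add_right (a : ℤ →₀ ℝ) (x y : ℤ → ℝ) :
    pairing a (x + y) = pairing a x + pairing a y := by
  simp [pairing, Finsupp.sum, mul_add, Finset.sum_add_distrib]

lemma pairing_smul_right (t : ℝ) (a : ℤ →₀ ℝ) (x : ℤ → ℝ) :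
    pairing a (t • x) = t * pairing a x := by simp [pairing_eq_bilinear]

lemma pairing_sum_right {ι : Type*} (s : Finset ι) (a : ℤ →₀ ℝ) (x : ι → ℤ → ℝ) :
    pairing a (∑ i ∈ s, x i) = ∑ i ∈ s, pairing a (x i) := by
  simp [pairing_eq_bilinear]

lemma continuous_pairing (a : ℤ →₀ ℝ) : Continuous (pairing a) := by
  unfold pairing Finsupp.sum; fun_prop

@[fun_prop]
lemma measurable_pairing (a : ℤ →₀ ℝ) : Measurable (pairing a) := (continuous_pairing a).measurable

/-- The character `x ↦ exp (i ∑ₖ aₖ xₖ)` of the path space. -/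
def character (a : ℤ →₀ ℝ) (x : ℤ → ℝ) : ℂ := Complex.exp (Complex.I * (pairing a x : ℂ))

/-- The characteristic function of a measure on the path space. -/
def pathCharFun (μ : Measure (ℤ → ℝ)) (a : ℤ →₀ ℝ) : ℂ := ∫ x, character a x ∂μ

@[simp] lemma norm_character (a : ℤ →₀ ℝ) (x : ℤ → ℝ) : ‖character a x‖ = 1 := by
  rw [character, mul_comm, Complex.norm_exp_ofReal_mul_I]

lemma continuous_character (a : ℤ →₀ ℝ) : Continuous (character a) := by
  have := continuous_pairing a
  unfold character; fun_prop

@[fun_prop]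
lemma measurable_character (a : ℤ →₀ ℝ) : Measurable (character a) :=
  (continuous_character a).measurable

lemma character_add_right (a : ℤ →₀ ℝ) (x y : ℤ → ℝ) :
    character a (x + y) = character a x * character a y := by
  simp [character, pairing_add_right, mul_add, Complex.exp_add]

lemma character_add_left (a b : ℤ →₀ ℝ) (x : ℤ → ℝ) :
    character (a + b) x = character a x * character b x := by
  simp [character, pairing_add_left, mul_add, Complex.exp_add]

lemma character_sum_right {ι : Type*} (s : Finset ι) (a : ℤ →₀ ℝ) (x : ι → ℤ → ℝ) :
    character a (∑ i ∈ s, x i) = ∏ i ∈ s, character a (x i) := by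
  simp [character, pairing_sum_right, Finset.mul_sum, Complex.exp_sum]

@[simp] lemma character_zero_left (x : ℤ → ℝ) : character 0 x = 1 := by simp [character]

@[simp] lemma character_zero_right (a : ℤ →₀ ℝ) : character a 0 = 1 := by simp [character]

lemma integrable_character (a : ℤ →₀ ℝ) (μ : Measure (ℤ → ℝ)) [IsFiniteMeasure μ] :
    Integrable (character a) μ :=
  (integrable_const (1 : ℝ)).mono' (measurable_character a).aestronglyMeasurable (by simp)

/-- Finite measures on the path space are determined by their characteristic functions. -/
theorem ext_of_pathCharFun {μ ν : Measure (ℤ → ℝ)} [IsFiniteMeasure μ] [IsFiniteMeasure ν]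
    (h : ∀ a, pathCharFun μ a = pathCharFun ν a) : μ = ν := by
  let _ := TopologicalSpace.upgradeIsCompletelyMetrizable (ℤ → ℝ)
  -- With discrete coefficients, joint continuity of the pairing reduces to continuity in the path
  -- for each fixed `a`.
  let _ : TopologicalSpace (ℤ →₀ ℝ) := ⊥
  have : DiscreteTopology (ℤ →₀ ℝ) := ⟨rfl⟩
  have hL : Continuous fun p : (ℤ → ℝ) × (ℤ →₀ ℝ) =>
      (Finsupp.bilinearCombination ℝ ℝ : (ℤ → ℝ) →ₗ[ℝ] _) p.1 p.2 := by
    rw [continuous_prod_of_discrete_right]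
    intro a
    simpa only [← pairing_eq_bilinear] using continuous_pairing a
  refine ext_of_integral_char_eq Real.continuous_probChar Real.probChar_ne_one
    (L := Finsupp.bilinearCombination ℝ ℝ) (fun v hv h0 => hv ?_) hL fun a => ?_
  · ext k
    have := congrArg (fun f => f (Finsupp.single k 1)) h0
    simpa [← pairing_eq_bilinear] using this
  · have := h a
    simp only [pathCharFun, character, pairing_eq_bilinear] at this
    simpa [BoundedContinuousFunction.char_apply, Real.probChar_apply,
      mul_comm] using this

lemma pathCharFun_conv (μ ν : Measure (ℤ → ℝ)) [IsFiniteMeasure μ] [IsFiniteMeasure ν]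
    (a : ℤ →₀ ℝ) : pathCharFun (μ ∗ ν) a = pathCharFun μ a * pathCharFun ν a := by
  simp only [pathCharFun]
  rw [integral_conv (integrable_character a _)]
  simp [character_add_right, integral_const_mul, integral_mul_const]

@[simp] lemma pathCharFun_dirac (b : ℤ → ℝ) (a : ℤ →₀ ℝ) :
    pathCharFun (Measure.dirac b) a = character a b := by
  simp [pathCharFun]

lemma pathCharFun_map {f : (ℤ → ℝ) → ℤ → ℝ} (hf : Measurable f) (μ : Measure (ℤ → ℝ))
    (a : ℤ →₀ ℝ) : pathCharFun (μ.map f) a = ∫ x, character a (f x) ∂μ := by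
  rw [pathCharFun, integral_map hf.aemeasurable (measurable_character a).aestronglyMeasurable]

lemma pathCharFun_add_measure (μ ν : Measure (ℤ → ℝ)) [IsFiniteMeasure μ] [IsFiniteMeasure ν]
    (a : ℤ →₀ ℝ) : pathCharFun (μ + ν) a = pathCharFun μ a + pathCharFun ν a :=
  integral_add_measure (integrable_character a μ) (integrable_character a ν)

lemma pathCharFun_smul_measure (c : ℝ≥0) (μ : Measure (ℤ → ℝ)) (a : ℤ →₀ ℝ) :
    pathCharFun (c • μ) a = c * pathCharFun μ a := by
  rw [pathCharFun, integral_smul_nnreal_measure, NNReal.smul_def]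
  simp [pathCharFun]

/-- The distribution of the sum of `n` independent processes of distribution `ν`. -/
def sumLaw (n : ℕ) (ν : Measure (ℤ → ℝ)) : Measure (ℤ → ℝ) :=
  (Measure.pi (fun _ : Fin n => ν)).map (fun y => ∑ i, y i)

lemma measurable_sum_paths (n : ℕ) : Measurable fun y : Fin n → ℤ → ℝ => ∑ i, y i := by fun_prop

instance (n : ℕ) (ν : Measure (ℤ → ℝ)) [IsProbabilityMeasure ν] :
    IsProbabilityMeasure (sumLaw n ν) :=
  Measure.isProbabilityMeasure_map (measurable_sum_paths n).aemeasurable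

lemma pathCharFun_sumLaw (n : ℕ) (ν : Measure (ℤ → ℝ)) [IsProbabilityMeasure ν] (a : ℤ →₀ ℝ) :
    pathCharFun (sumLaw n ν) a = pathCharFun ν a ^ n := by
  rw [pathCharFun, sumLaw, integral_map (measurable_sum_paths n).aemeasurable
    (measurable_character a).aestronglyMeasurable]
  simp_rw [character_sum_right]
  rw [integral_fintype_prod_eq_prod (𝕜 := ℂ) (fun _ => character a)]
  simp [pathCharFun]

/-! ### Tightness and Lévy's continuity theorem -/

/-- A product of compact sets is compact, and countably many marginal errors `δ k` can be chosen
with sum below `ε`. -/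
lemma isTightMeasureSet_of_marginals {μ : ℕ → Measure (ℤ → ℝ)}
    (h : ∀ k : ℤ, IsTightMeasureSet (Set.range fun n => (μ n).map fun x => x k)) :
    IsTightMeasureSet (Set.range μ) := by
  rw [isTightMeasureSet_iff_exists_isCompact_measure_compl_le]
  intro ε hε
  obtain ⟨δ, hδ, hδε⟩ := ENNReal.exists_pos_sum_of_countable' hε.ne' ℤ
  have hK (k : ℤ) : ∃ K : Set ℝ, IsCompact K ∧ ∀ n, μ n ((fun x => x k) ⁻¹' Kᶜ) ≤ δ k := by
    obtain ⟨K, hK, hμ⟩ :=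
      isTightMeasureSet_iff_exists_isCompact_measure_compl_le.1 (h k) (δ k) (hδ k)
    refine ⟨K, hK, fun n => ?_⟩
    have := hμ _ ⟨n, rfl⟩
    rwa [Measure.map_apply (measurable_pi_apply k) hK.measurableSet.compl] at this
  choose K hK hμ using hK
  refine ⟨Set.univ.pi K, isCompact_univ_pi hK, ?_⟩
  rintro _ ⟨n, rfl⟩
  calc μ n (Set.univ.pi K)ᶜ ≤ μ n (⋃ k, (fun x : ℤ → ℝ => x k) ⁻¹' (K k)ᶜ) := by
        refine measure_mono fun x hx => ?_
        simpa [Set.mem_pi] using hx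
    _ ≤ ∑' k, μ n ((fun x : ℤ → ℝ => x k) ⁻¹' (K k)ᶜ) := measure_iUnion_le _
    _ ≤ ∑' k, δ k := ENNReal.tsum_le_tsum fun k => hμ k n
    _ ≤ ε := hδε.le

lemma charFun_map_eval (μ : Measure (ℤ → ℝ)) (k : ℤ) (t : ℝ) :
    charFun (μ.map fun x => x k) t = pathCharFun μ (Finsupp.single k t) := by
  rw [charFun_apply_real, integral_map (measurable_pi_apply k).aemeasurable (by fun_prop)]
  simp only [pathCharFun, character, pairing_single]
  congr with x
  push_cast
  ring_nf

/-- Lévy's continuity theorem on the path space. -/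
theorem exists_of_tendsto_pathCharFun {μ : ℕ → Measure (ℤ → ℝ)} [∀ n, IsProbabilityMeasure (μ n)]
    {φ : (ℤ →₀ ℝ) → ℂ} (h : ∀ a, Tendsto (fun n => pathCharFun (μ n) a) atTop (𝓝 (φ a)))
    (hφ : ∀ k, ContinuousAt (fun t : ℝ => φ (Finsupp.single k t)) 0) :
    ∃ P : Measure (ℤ → ℝ), IsProbabilityMeasure P ∧ ∀ a, pathCharFun P a = φ a := by
  have htight : IsTightMeasureSet (Set.range μ) := by
    refine isTightMeasureSet_of_marginals fun k => ?_
    have (n : ℕ) : IsProbabilityMeasure ((μ n).map fun x => x k) :=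
      Measure.isProbabilityMeasure_map (measurable_pi_apply k).aemeasurable
    refine isTightMeasureSet_of_tendsto_charFun (hφ k) fun t => ?_
    simpa only [charFun_map_eval] using h (Finsupp.single k t)
  let ν : ℕ → ProbabilityMeasure (ℤ → ℝ) := fun n => ⟨μ n, inferInstance⟩
  have hcompact : IsCompact (closure (Set.range ν)) := by
    refine isCompact_closure_of_isTightMeasureSet (htight.subset ?_)
    rintro _ ⟨_, ⟨n, rfl⟩, rfl⟩
    exact ⟨n, rfl⟩
  -- Only existence is needed, so a limit along one ultrafilter finer than `atTop` suffices: its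
  -- characteristic function must be `φ`.
  let U : Ultrafilter ℕ := Ultrafilter.of atTop
  obtain ⟨P, -, hP⟩ := hcompact.ultrafilter_le_nhds (U.map ν)
    (le_principal_iff.2 (mem_map.2 (univ_mem' fun n => subset_closure ⟨n, rfl⟩)))
  have hP' : Tendsto ν U (𝓝 P) := hP
  rw [ProbabilityMeasure.tendsto_iff_forall_integral_rclike_tendsto ℂ] at hP'
  refine ⟨P, inferInstance, fun a => ?_⟩
  refine tendsto_nhds_unique ?_ ((h a).mono_left (Ultrafilter.of_le atTop))
  exact hP' (BoundedContinuousFunction.ofNormedAddCommGroup (character a)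
    (continuous_character a) 1 (by simp))

/-! ### The Lévy–Khintchine exponent: bounds and continuity -/

/-- The conditions on a measure on the path space to be the Lévy measure of a process. -/
structure IsLevyMeasureCandidate (Q : Measure (ℤ → ℝ)) : Prop where
  zero_path : Q {0} = 0
  lintegral_lt_top : ∀ k : ℤ, ∫⁻ x : ℤ → ℝ, ENNReal.ofReal (min (x k ^ 2) 1) ∂Q < ∞

lemma HasLevyTriplet.isLevyMeasureCandidate {P Q : Measure (ℤ → ℝ)} {Γ : Matrix ℤ ℤ ℝ} {b : ℤ → ℝ}
    (h : HasLevyTriplet P Γ b Q) : IsLevyMeasureCandidate Q := ⟨h.zero_path, h.lintegral_lt_top⟩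

/-- The bilinear form `∑ⱼₖ aⱼ Γⱼₖ cₖ`. -/
def covForm (Γ : Matrix ℤ ℤ ℝ) (a c : ℤ →₀ ℝ) : ℝ := pairing a fun j => pairing c (Γ j)

lemma covForm_eq_sum (Γ : Matrix ℤ ℤ ℝ) (a c : ℤ →₀ ℝ) :
    covForm Γ a c = a.sum fun j r => c.sum fun k s => r * Γ j k * s := by
  simp only [covForm, pairing, Finsupp.sum, Finset.mul_sum]
  exact Finset.sum_congr rfl fun j _ => Finset.sum_congr rfl fun k _ => by ring

lemma covForm_add_left (Γ : Matrix ℤ ℤ ℝ) (a a' c : ℤ →₀ ℝ) :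
    covForm Γ (a + a') c = covForm Γ a c + covForm Γ a' c := pairing_add_left _ _ _

lemma covForm_sub_left (Γ : Matrix ℤ ℤ ℝ) (a a' c : ℤ →₀ ℝ) :
    covForm Γ (a - a') c = covForm Γ a c - covForm Γ a' c := pairing_sub_left _ _ _

lemma covForm_add_right (Γ : Matrix ℤ ℤ ℝ) (a c c' : ℤ →₀ ℝ) :
    covForm Γ a (c + c') = covForm Γ a c + covForm Γ a c' := by
  simp only [covForm, pairing_add_left]
  exact pairing_add_right _ _ _

lemma covForm_smul_left (Γ : Matrix ℤ ℤ ℝ) (t : ℝ) (a c : ℤ →₀ ℝ) :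
    covForm Γ (t • a) c = t * covForm Γ a c := pairing_smul_left _ _ _

lemma covForm_smul_right (Γ : Matrix ℤ ℤ ℝ) (t : ℝ) (a c : ℤ →₀ ℝ) :
    covForm Γ a (t • c) = t * covForm Γ a c := by
  simp only [covForm, pairing_smul_left]
  exact pairing_smul_right _ _ _

lemma covForm_sub_right (Γ : Matrix ℤ ℤ ℝ) (a c c' : ℤ →₀ ℝ) :
    covForm Γ a (c - c') = covForm Γ a c - covForm Γ a c' := by
  have : c - c' = c + (-1 : ℝ) • c' := by module
  rw [this, covForm_add_right, covForm_smul_right]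
  ring

lemma covForm_add_matrix (Γ Γ' : Matrix ℤ ℤ ℝ) (a c : ℤ →₀ ℝ) :
    covForm (Γ + Γ') a c = covForm Γ a c + covForm Γ' a c := by
  rw [covForm, covForm, covForm, ← pairing_add_right]
  congr with j
  exact pairing_add_right _ _ _

@[simp] lemma covForm_zero_matrix (a c : ℤ →₀ ℝ) : covForm 0 a c = 0 := by
  simp [covForm, pairing]

lemma covForm_nonneg {Γ : Matrix ℤ ℤ ℝ} (hΓ : Γ.PosSemidef) (a : ℤ →₀ ℝ) : 0 ≤ covForm Γ a a := by
  rw [covForm_eq_sum]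
  simpa using hΓ.2 a

/-- The path truncated coordinatewise. -/
def truncPath (x : ℤ → ℝ) : ℤ → ℝ := fun k => trunc (x k)

lemma continuous_trunc : Continuous trunc := by unfold trunc; fun_prop

lemma abs_trunc_le (r : ℝ) : |trunc r| ≤ 1 := by
  rw [trunc, abs_le]
  exact ⟨le_max_left _ _, max_le (by norm_num) (min_le_right _ _)⟩

lemma trunc_of_abs_le {r : ℝ} (h : |r| ≤ 1) : trunc r = r := by
  rw [abs_le] at h
  rw [trunc, min_eq_left h.2, max_eq_right h.1]

@[fun_prop]
lemma continuous_truncPath : Continuous truncPath :=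
  continuous_pi fun k => continuous_trunc.comp (continuous_apply k)

/-- The integrand of the Lévy–Khintchine exponent. -/
def levyIntegrand (a : ℤ →₀ ℝ) (x : ℤ → ℝ) : ℂ :=
  character a x - 1 - Complex.I * (pairing a (truncPath x) : ℂ)

lemma levyExponent_eq (Γ : Matrix ℤ ℤ ℝ) (b : ℤ → ℝ) (Q : Measure (ℤ → ℝ)) (a : ℤ →₀ ℝ) :
    levyExponent Γ b Q a = Complex.I * (pairing a b : ℂ) - ((1 / 2 * covForm Γ a a : ℝ) : ℂ)
      + ∫ x, levyIntegrand a x ∂Q := by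
  rw [covForm_eq_sum]; rfl

lemma continuous_levyIntegrand (a : ℤ →₀ ℝ) : Continuous (levyIntegrand a) := by
  have := continuous_pairing a
  have := continuous_character a
  unfold levyIntegrand
  fun_prop

lemma norm_exp_mul_I_sub_one_sub_le (u : ℝ) :
    ‖Complex.exp (Complex.I * u) - 1 - Complex.I * u‖ ≤ 3 * u ^ 2 := by
  have hn : ‖Complex.I * (u : ℂ)‖ = |u| := by simp
  by_cases hu : |u| ≤ 1
  · have := Complex.norm_exp_sub_one_sub_id_le (x := Complex.I * u) (by rwa [hn])
    rw [hn, sq_abs] at this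
    nlinarith [sq_nonneg u]
  · push Not at hu
    calc ‖Complex.exp (Complex.I * u) - 1 - Complex.I * u‖
        ≤ ‖Complex.exp (Complex.I * u)‖ + ‖(1 : ℂ)‖ + ‖Complex.I * (u : ℂ)‖ :=
          (norm_sub_le _ _).trans (by gcongr; exact norm_sub_le _ _)
      _ = 2 + |u| := by
          rw [hn, mul_comm, Complex.norm_exp_ofReal_mul_I]; norm_num
      _ ≤ 3 * u ^ 2 := by rw [← sq_abs]; nlinarith

/-- The constant in the bound of the Lévy–Khintchine integrand. -/
def levyBound (a : ℤ →₀ ℝ) (t : ℝ) : ℝ :=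
  2 + |t| * ∑ k ∈ a.support, |a k| + 3 * t ^ 2 * ∑ k ∈ a.support, a k ^ 2

lemma levyBound_le {a : ℤ →₀ ℝ} {s t : ℝ} (h : |s| ≤ |t|) : levyBound a s ≤ levyBound a t := by
  have := sq_le_sq.2 h
  have : 0 ≤ ∑ k ∈ a.support, a k ^ 2 := Finset.sum_nonneg fun _ _ => sq_nonneg _
  unfold levyBound
  gcongr

/-- If all relevant coordinates are at most 1 in absolute value, truncation does nothing, and the
quadratic bound on `e^{iu} - 1 - iu` combines with Cauchy–Schwarz. Otherwise some `min (x k ^ 2) 1`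
equals 1 and a crude bound is enough. Keeping `t` explicit gives a domination uniform over bounded
`t`. -/
lemma norm_levyIntegrand_smul_le (a : ℤ →₀ ℝ) (t : ℝ) (x : ℤ → ℝ) :
    ‖levyIntegrand (t • a) x‖ ≤ levyBound a t * ∑ k ∈ a.support, min (x k ^ 2) 1 := by
  have h1 : 0 ≤ |t| * ∑ k ∈ a.support, |a k| := by positivity
  have h2 : 0 ≤ 3 * t ^ 2 * ∑ k ∈ a.support, a k ^ 2 := by positivity
  have hmin (k : ℤ) : 0 ≤ min (x k ^ 2) 1 := by positivity
  have hC : 2 + |t| * ∑ k ∈ a.support, |a k| ≤ levyBound a t := by unfold levyBound; linarith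
  have hC' : 3 * t ^ 2 * ∑ k ∈ a.support, a k ^ 2 ≤ levyBound a t := by unfold levyBound; linarith
  by_cases hx : ∀ k ∈ a.support, |x k| ≤ 1
  · have htr : pairing a (truncPath x) = pairing a x := by
      rw [pairing_eq_sum, pairing_eq_sum]
      exact Finset.sum_congr rfl fun k hk => by rw [truncPath, trunc_of_abs_le (hx k hk)]
    have hm : ∑ k ∈ a.support, min (x k ^ 2) 1 = ∑ k ∈ a.support, x k ^ 2 :=
      Finset.sum_congr rfl fun k hk => min_eq_left ((sq_le_one_iff_abs_le_one _).2 (hx k hk))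
    have hCS : pairing a x ^ 2 ≤ (∑ k ∈ a.support, a k ^ 2) * ∑ k ∈ a.support, x k ^ 2 :=
      Finset.sum_mul_sq_le_sq_mul_sq _ _ _
    have hS : 0 ≤ ∑ k ∈ a.support, x k ^ 2 := by positivity
    rw [levyIntegrand, character, pairing_smul_left, pairing_smul_left, htr, hm]
    calc _ ≤ 3 * (t * pairing a x) ^ 2 := norm_exp_mul_I_sub_one_sub_le _
      _ = 3 * t ^ 2 * pairing a x ^ 2 := by ring
      _ ≤ 3 * t ^ 2 * ((∑ k ∈ a.support, a k ^ 2) * ∑ k ∈ a.support, x k ^ 2) := by gcongr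
      _ = 3 * t ^ 2 * (∑ k ∈ a.support, a k ^ 2) * ∑ k ∈ a.support, x k ^ 2 := by ring
      _ ≤ _ := by gcongr
  · push Not at hx
    obtain ⟨k₀, hk₀, hx₀⟩ := hx
    have hS : 1 ≤ ∑ k ∈ a.support, min (x k ^ 2) 1 := by
      calc (1 : ℝ) = min (x k₀ ^ 2) 1 :=
            (min_eq_right (by rw [← sq_abs]; nlinarith [abs_nonneg (x k₀)])).symm
        _ ≤ _ := Finset.single_le_sum (f := fun k => min (x k ^ 2) 1) (fun k _ => hmin k) hk₀
    have hp : |pairing a (truncPath x)| ≤ ∑ k ∈ a.support, |a k| := by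
      rw [pairing_eq_sum]
      refine (Finset.abs_sum_le_sum_abs _ _).trans (Finset.sum_le_sum fun k _ => ?_)
      rw [abs_mul]
      exact mul_le_of_le_one_right (abs_nonneg _) (abs_trunc_le _)
    calc ‖levyIntegrand (t • a) x‖
        ≤ ‖character (t • a) x‖ + ‖(1 : ℂ)‖
          + ‖Complex.I * (pairing (t • a) (truncPath x) : ℂ)‖ :=
          (norm_sub_le _ _).trans (by gcongr; exact norm_sub_le _ _)
      _ = 2 + |t| * |pairing a (truncPath x)| := by
          rw [pairing_smul_left]; simp; norm_num
      _ ≤ 2 + |t| * ∑ k ∈ a.support, |a k| := by gcongr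
      _ ≤ levyBound a t := hC
      _ ≤ _ := le_mul_of_one_le_right (h1.trans (by linarith)) hS

namespace IsLevyMeasureCandidate

variable {Q Q' : Measure (ℤ → ℝ)}

lemma integrable_min (hQ : IsLevyMeasureCandidate Q) (k : ℤ) :
    Integrable (fun x : ℤ → ℝ => min (x k ^ 2) 1) Q := by
  refine ⟨(by fun_prop : Measurable _).aestronglyMeasurable, ?_⟩
  rw [hasFiniteIntegral_iff_ofReal (ae_of_all _ fun x => by positivity)]
  exact hQ.lintegral_lt_top k

lemma integrable_sum_min (hQ : IsLevyMeasureCandidate Q) (s : Finset ℤ) :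
    Integrable (fun x : ℤ → ℝ => ∑ k ∈ s, min (x k ^ 2) 1) Q :=
  integrable_finsetSum _ fun k _ => hQ.integrable_min k

lemma integrable_levyIntegrand (hQ : IsLevyMeasureCandidate Q) (a : ℤ →₀ ℝ) :
    Integrable (levyIntegrand a) Q := by
  refine ((hQ.integrable_sum_min a.support).const_mul (levyBound a 1)).mono'
    (continuous_levyIntegrand a).aestronglyMeasurable (ae_of_all _ fun x => ?_)
  simpa using norm_levyIntegrand_smul_le a 1 x

/-- Continuity along rays is all that is used later: for the uniqueness of logarithms and at the
origin in Lévy's continuity theorem. -/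
lemma continuous_integral_smul (hQ : IsLevyMeasureCandidate Q) (a : ℤ →₀ ℝ) :
    Continuous fun t : ℝ => ∫ x, levyIntegrand (t • a) x ∂Q := by
  rw [continuous_iff_continuousAt]
  intro t₀
  refine continuousAt_of_dominated
    (bound := fun x => levyBound a (|t₀| + 1) * ∑ k ∈ a.support, min (x k ^ 2) 1)
    (Eventually.of_forall fun t => (continuous_levyIntegrand _).aestronglyMeasurable) ?_
    ((hQ.integrable_sum_min a.support).const_mul _) (ae_of_all _ fun x => ?_)
  · filter_upwards [Metric.ball_mem_nhds t₀ one_pos] with t ht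
    refine ae_of_all _ fun x => (norm_levyIntegrand_smul_le a t x).trans ?_
    have : 0 ≤ ∑ k ∈ a.support, min (x k ^ 2) 1 := Finset.sum_nonneg fun k _ => by positivity
    gcongr
    refine levyBound_le ?_
    rw [Metric.mem_ball, Real.dist_eq] at ht
    rw [abs_of_nonneg (by positivity : 0 ≤ |t₀| + 1)]
    have := abs_add_le (t - t₀) t₀
    rw [sub_add_cancel] at this
    linarith
  · simp only [levyIntegrand, character, pairing_smul_left]
    fun_prop

lemma add (hQ : IsLevyMeasureCandidate Q) (hQ' : IsLevyMeasureCandidate Q') :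
    IsLevyMeasureCandidate (Q + Q') where
  zero_path := by simp [hQ.zero_path, hQ'.zero_path]
  lintegral_lt_top k := by
    rw [lintegral_add_measure]
    exact ENNReal.add_lt_top.2 ⟨hQ.lintegral_lt_top k, hQ'.lintegral_lt_top k⟩

lemma mono (hQ : IsLevyMeasureCandidate Q) (h : Q' ≤ Q) : IsLevyMeasureCandidate Q' where
  zero_path := le_antisymm ((h _).trans_eq hQ.zero_path) zero_le
  lintegral_lt_top k := (lintegral_mono' h le_rfl).trans_lt (hQ.lintegral_lt_top k)

lemma smul (hQ : IsLevyMeasureCandidate Q) (c : ℝ≥0) : IsLevyMeasureCandidate (c • Q) where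
  zero_path := by simp [hQ.zero_path]
  lintegral_lt_top k := by
    rw [lintegral_smul_measure, ENNReal.smul_def]
    exact ENNReal.mul_lt_top ENNReal.coe_lt_top (hQ.lintegral_lt_top k)

end IsLevyMeasureCandidate

lemma continuous_levyExponent_smul (Γ : Matrix ℤ ℤ ℝ) (b : ℤ → ℝ) {Q : Measure (ℤ → ℝ)}
    (hQ : IsLevyMeasureCandidate Q) (a : ℤ →₀ ℝ) :
    Continuous fun t : ℝ => levyExponent Γ b Q (t • a) := by
  have := hQ.continuous_integral_smul a
  simp only [levyExponent_eq, pairing_smul_left, covForm_smul_left, covForm_smul_right]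
  fun_prop

@[simp] lemma levyIntegrand_zero (x : ℤ → ℝ) : levyIntegrand 0 x = 0 := by simp [levyIntegrand]

@[simp] lemma levyExponent_zero (Γ : Matrix ℤ ℤ ℝ) (b : ℤ → ℝ) (Q : Measure (ℤ → ℝ)) :
    levyExponent Γ b Q 0 = 0 := by
  simp [levyExponent_eq, covForm]

lemma levyExponent_add (Γ Γ' : Matrix ℤ ℤ ℝ) (b b' : ℤ → ℝ) {Q Q' : Measure (ℤ → ℝ)}
    (hQ : IsLevyMeasureCandidate Q) (hQ' : IsLevyMeasureCandidate Q') (a : ℤ →₀ ℝ) :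
    levyExponent (Γ + Γ') (b + b') (Q + Q') a = levyExponent Γ b Q a + levyExponent Γ' b' Q' a := by
  rw [levyExponent_eq, levyExponent_eq, levyExponent_eq, integral_add_measure
    (hQ.integrable_levyIntegrand a) (hQ'.integrable_levyIntegrand a), pairing_add_right,
    covForm_add_matrix]
  push_cast
  ring

/-! ### Uniqueness of the Lévy measure -/

/-- The values lie in the discrete set `2πiℤ`, and `ℝ` is connected. -/
lemma eq_zero_of_continuous_of_exp_eq_one {f : ℝ → ℂ} (hf : Continuous f) (h0 : f 0 = 0)
    (h : ∀ t, Complex.exp (f t) = 1) (t : ℝ) : f t = 0 := by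
  choose n hn using fun t => Complex.exp_eq_one_iff.1 (h t)
  have hn' (t : ℝ) : (n t : ℝ) = (f t).im / (2 * Real.pi) := by
    have := congrArg Complex.im (hn t)
    simp only [Complex.mul_im, Complex.intCast_re, Complex.intCast_im, zero_mul, add_zero] at this
    simp at this
    rw [this]
    field_simp
  have hc : Continuous n := by
    rw [Int.isClosedEmbedding_coe_real.isEmbedding.continuous_iff]
    have : (Int.cast ∘ n : ℝ → ℝ) = fun t => (f t).im / (2 * Real.pi) := funext hn'
    rw [this]
    exact (Complex.continuous_im.comp hf).div_const _
  have h1 : n t = n 0 := PreconnectedSpace.constant inferInstance hc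
  have h2 : (n 0 : ℝ) = 0 := by rw [hn' 0, h0]; simp
  rw [hn t, h1]
  have : n 0 = 0 := by exact_mod_cast h2
  simp [this]

lemma levyExponent_eq_of_exp_eq {Γ Γ' : Matrix ℤ ℤ ℝ} {b b' : ℤ → ℝ} {Q Q' : Measure (ℤ → ℝ)}
    (hQ : IsLevyMeasureCandidate Q) (hQ' : IsLevyMeasureCandidate Q')
    (h : ∀ a, Complex.exp (levyExponent Γ b Q a) = Complex.exp (levyExponent Γ' b' Q' a))
    (a : ℤ →₀ ℝ) : levyExponent Γ b Q a = levyExponent Γ' b' Q' a := by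
  have := eq_zero_of_continuous_of_exp_eq_one
    (f := fun t => levyExponent Γ b Q (t • a) - levyExponent Γ' b' Q' (t • a))
    ((continuous_levyExponent_smul Γ b hQ a).sub (continuous_levyExponent_smul Γ' b' hQ' a))
    (by simp) (fun t => by rw [Complex.exp_sub, h, div_self (Complex.exp_ne_zero _)]) 1
  simpa [sub_eq_zero] using this

/-- The nonnegative weight `1 - cos ⟨h, x⟩`. -/
def cosWeight (h : ℤ →₀ ℝ) (x : ℤ → ℝ) : ℝ := 1 - Real.cos (pairing h x)

lemma cosWeight_nonneg (h : ℤ →₀ ℝ) (x : ℤ → ℝ) : 0 ≤ cosWeight h x :=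
  sub_nonneg.2 (Real.cos_le_one _)

@[fun_prop]
lemma measurable_cosWeight (h : ℤ →₀ ℝ) : Measurable (cosWeight h) := by
  unfold cosWeight; fun_prop

/-- The symmetrized measure `(1 - cos ⟨h, x⟩) Q(dx)`, together with the contribution of the Gaussian
part as an atom at the zero path. -/
def symmetrization (Γ : Matrix ℤ ℤ ℝ) (Q : Measure (ℤ → ℝ)) (h : ℤ →₀ ℝ) : Measure (ℤ → ℝ) :=
  Q.withDensity (fun x => ENNReal.ofReal (cosWeight h x))
    + (1 / 2 * covForm Γ h h).toNNReal • Measure.dirac 0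

/-- The second difference in `a` kills the constant and the linear compensator; averaging the
characters at `a ± h` multiplies `character a` by `cos ⟨h, x⟩`. -/
lemma character_sub_mean (a h : ℤ →₀ ℝ) (x : ℤ → ℝ) :
    levyIntegrand a x - 1 / 2 * (levyIntegrand (a + h) x + levyIntegrand (a - h) x)
      = (cosWeight h x : ℂ) * character a x := by
  have h1 : character (a - h) x = character a x * Complex.exp (-(pairing h x) * Complex.I) := by
    rw [character, character, ← Complex.exp_add, pairing_sub_left]
    push_cast
    ring_nf
  have h2 : character h x = Complex.exp (pairing h x * Complex.I) := by
    rw [character, mul_comm]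
  rw [levyIntegrand, levyIntegrand, levyIntegrand, character_add_left, h1, h2, cosWeight,
    pairing_add_left, pairing_sub_left]
  push_cast
  rw [Complex.cos]
  ring

lemma re_levyIntegrand (h : ℤ →₀ ℝ) (x : ℤ → ℝ) : (levyIntegrand h x).re = -cosWeight h x := by
  rw [levyIntegrand, character, mul_comm, cosWeight]
  simp [Complex.exp_ofReal_mul_I_re]

lemma IsLevyMeasureCandidate.integrable_cosWeight {Q : Measure (ℤ → ℝ)}
    (hQ : IsLevyMeasureCandidate Q) (h : ℤ →₀ ℝ) : Integrable (cosWeight h) Q := by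
  have := (hQ.integrable_levyIntegrand h).re.neg
  refine this.congr (ae_of_all _ fun x => ?_)
  simp [re_levyIntegrand]

lemma IsLevyMeasureCandidate.isFiniteMeasure_withDensity {Q : Measure (ℤ → ℝ)}
    (hQ : IsLevyMeasureCandidate Q) (h : ℤ →₀ ℝ) :
    IsFiniteMeasure (Q.withDensity fun x => ENNReal.ofReal (cosWeight h x)) :=
  isFiniteMeasure_withDensity_ofReal (hQ.integrable_cosWeight h).2

lemma IsLevyMeasureCandidate.isFiniteMeasure_symmetrization {Q : Measure (ℤ → ℝ)}
    (hQ : IsLevyMeasureCandidate Q) (Γ : Matrix ℤ ℤ ℝ) (h : ℤ →₀ ℝ) :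
    IsFiniteMeasure (symmetrization Γ Q h) := by
  have := hQ.isFiniteMeasure_withDensity h
  unfold symmetrization
  infer_instance

/-- The linear drift cancels in the second difference, and the quadratic Gaussian term leaves the
constant `½ covForm Γ h h` by the parallelogram identity. A constant is the transform of an atom at
the zero path. -/
lemma pathCharFun_symmetrization {Γ : Matrix ℤ ℤ ℝ} (hΓ : Γ.PosSemidef) (b : ℤ → ℝ)
    {Q : Measure (ℤ → ℝ)} (hQ : IsLevyMeasureCandidate Q) (h a : ℤ →₀ ℝ) :
    pathCharFun (symmetrization Γ Q h) a = levyExponent Γ b Q a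
      - 1 / 2 * (levyExponent Γ b Q (a + h) + levyExponent Γ b Q (a - h)) := by
  have := hQ.isFiniteMeasure_withDensity h
  have hd : pathCharFun (Q.withDensity fun x => ENNReal.ofReal (cosWeight h x)) a
      = ∫ x, (cosWeight h x : ℂ) * character a x ∂Q := by
    rw [pathCharFun, integral_withDensity_eq_integral_toReal_smul (by fun_prop)
      (ae_of_all _ fun x => ENNReal.ofReal_lt_top)]
    congr with x
    rw [ENNReal.toReal_ofReal (cosWeight_nonneg h x), Complex.real_smul]
  have hint := hQ.integrable_levyIntegrand
  rw [symmetrization, pathCharFun_add_measure, pathCharFun_smul_measure, hd, pathCharFun_dirac]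
  simp_rw [← character_sub_mean]
  have hadd : Integrable (fun x => levyIntegrand (a + h) x + levyIntegrand (a - h) x) Q :=
    (hint _).add (hint _)
  rw [integral_sub (hint a) (hadd.const_mul _), integral_const_mul,
    integral_add (hint _) (hint _), levyExponent_eq, levyExponent_eq, levyExponent_eq]
  have hq : 0 ≤ 1 / 2 * covForm Γ h h := mul_nonneg (by norm_num) (covForm_nonneg hΓ h)
  have hq' : (((1 / 2 * covForm Γ h h).toNNReal : ℝ) : ℂ) = ((1 / 2 * covForm Γ h h : ℝ) : ℂ) := by
    rw [Real.coe_toNNReal _ hq]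
  rw [show (((1 / 2 * covForm Γ h h).toNNReal : ℂ)) = (((1 / 2 * covForm Γ h h).toNNReal : ℝ) : ℂ)
    from rfl, hq']
  simp only [pairing_add_left, pairing_sub_left, covForm_add_left, covForm_add_right,
    covForm_sub_left, covForm_sub_right, character_zero_right]
  push_cast
  ring

/-- The set of paths which are nonzero and smaller than `n + 1` in absolute value at time `k`. -/
def boundedAt (k : ℤ) (n : ℕ) : Set (ℤ → ℝ) := {x | x k ≠ 0 ∧ |x k| < n + 1}

lemma measurableSet_boundedAt (k : ℤ) (n : ℕ) : MeasurableSet (boundedAt k n) := by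
  have h : Measurable fun x : ℤ → ℝ => x k := measurable_pi_apply k
  exact (h (measurableSet_singleton (0 : ℝ))).compl.inter
    (measurableSet_lt (continuous_abs.measurable.comp h) measurable_const)

lemma iUnion_boundedAt : ⋃ p : ℤ × ℕ, boundedAt p.1 p.2 = ({0} : Set (ℤ → ℝ))ᶜ := by
  ext x
  simp only [boundedAt, Set.mem_iUnion, Prod.exists, Set.mem_ofPred_eq, Set.mem_compl_iff,
    Set.mem_singleton_iff]
  constructor
  · rintro ⟨k, n, hk, -⟩ rfl
    exact hk rfl
  · intro hx
    obtain ⟨k, hk⟩ := Function.ne_iff.1 hx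
    obtain ⟨n, hn⟩ := exists_nat_gt |x k|
    exact ⟨k, n, hk, by linarith⟩

/-- The frequency `1 / (n + 1)` puts the phase strictly between `-1` and `1`, where the cosine
equals 1 only at 0. -/
lemma cosWeight_pos_of_mem_boundedAt {k : ℤ} {n : ℕ} {x : ℤ → ℝ} (hx : x ∈ boundedAt k n) :
    0 < cosWeight (Finsupp.single k ((n : ℝ) + 1)⁻¹) x := by
  obtain ⟨h0, h1⟩ := hx
  have hn : (0 : ℝ) < n + 1 := by positivity
  rw [cosWeight, pairing_single, sub_pos]
  have hlt : |((n : ℝ) + 1)⁻¹ * x k| < 1 := by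
    rw [abs_mul, abs_of_pos (by positivity), inv_mul_lt_iff₀ hn]
    simpa using h1
  refine lt_of_le_of_ne (Real.cos_le_one _) fun h => ?_
  rw [Real.cos_eq_one_iff_of_lt_of_lt (by linarith [(abs_lt.1 hlt).1, Real.pi_gt_three])
    (by linarith [(abs_lt.1 hlt).2, Real.pi_gt_three])] at h
  simp [h0, hn.ne'] at h

/-- The zero path lies outside `boundedAt k n`, so the Gaussian atom disappears; the remaining
weight is positive there and can be divided out. -/
lemma restrict_eq_of_symmetrization_eq {Γ Γ' : Matrix ℤ ℤ ℝ} {Q Q' : Measure (ℤ → ℝ)}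
    (h : ∀ a, symmetrization Γ Q a = symmetrization Γ' Q' a) (k : ℤ) (n : ℕ) :
    Q.restrict (boundedAt k n) = Q'.restrict (boundedAt k n) := by
  set a := Finsupp.single k ((n : ℝ) + 1)⁻¹
  set f : (ℤ → ℝ) → ℝ≥0∞ := fun x => ENNReal.ofReal (cosWeight a x)
  have hs := measurableSet_boundedAt k n
  have hf : Measurable f := by fun_prop
  have hr (Γ : Matrix ℤ ℤ ℝ) (Q : Measure (ℤ → ℝ)) :
      (symmetrization Γ Q a).restrict (boundedAt k n)
        = (Q.restrict (boundedAt k n)).withDensity f := by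
    have h0 : (Measure.dirac (0 : ℤ → ℝ)).restrict (boundedAt k n) = 0 := by
      rw [Measure.restrict_eq_zero, Measure.dirac_apply' _ hs]
      simp [boundedAt]
    rw [symmetrization, Measure.restrict_add, Measure.restrict_smul, h0, smul_zero, add_zero,
      restrict_withDensity hs]
  have hinv (Q : Measure (ℤ → ℝ)) :
      ((Q.restrict (boundedAt k n)).withDensity f).withDensity f⁻¹
        = Q.restrict (boundedAt k n) := by
    refine withDensity_inv_same hf ?_ (ae_of_all _ fun x => ENNReal.ofReal_ne_top)
    refine (ae_restrict_iff' hs).2 (ae_of_all _ fun x hx => ?_)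
    simpa [f] using cosWeight_pos_of_mem_boundedAt hx
  rw [← hinv Q, ← hinv Q', ← hr Γ Q, ← hr Γ' Q', h]

/-- The Lévy measure is determined by the characteristic function. -/
theorem levyMeasure_unique {Γ Γ' : Matrix ℤ ℤ ℝ} {b b' : ℤ → ℝ} {Q Q' : Measure (ℤ → ℝ)}
    (hΓ : Γ.PosSemidef) (hΓ' : Γ'.PosSemidef)
    (hQ : IsLevyMeasureCandidate Q) (hQ' : IsLevyMeasureCandidate Q')
    (h : ∀ a, Complex.exp (levyExponent Γ b Q a) = Complex.exp (levyExponent Γ' b' Q' a)) :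
    Q = Q' := by
  have hψ := levyExponent_eq_of_exp_eq hQ hQ' h
  have hsymm (c : ℤ →₀ ℝ) : symmetrization Γ Q c = symmetrization Γ' Q' c := by
    have := hQ.isFiniteMeasure_symmetrization Γ c
    have := hQ'.isFiniteMeasure_symmetrization Γ' c
    refine ext_of_pathCharFun fun a => ?_
    rw [pathCharFun_symmetrization hΓ b hQ, pathCharFun_symmetrization hΓ' b' hQ']
    simp only [hψ]
  have hU : Q.restrict {0}ᶜ = Q'.restrict {0}ᶜ := by
    rw [← iUnion_boundedAt, Measure.restrict_iUnion_congr]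
    exact fun p => restrict_eq_of_symmetrization_eq hsymm p.1 p.2
  have hne {Q : Measure (ℤ → ℝ)} (hQ : IsLevyMeasureCandidate Q) : Q.restrict {0}ᶜ = Q :=
    Measure.restrict_eq_self_of_ae_mem (compl_mem_ae_iff.2 hQ.zero_path)
  rw [← hne hQ, ← hne hQ', hU]

/-! ### Existence of processes with a given Lévy measure -/

/-- By Markov's inequality the sets where `min (x k ^ 2) 1` exceeds a positive level have finite
measure; with the null set `{0}` they cover the space. -/
lemma IsLevyMeasureCandidate.sigmaFinite {Q : Measure (ℤ → ℝ)} (hQ : IsLevyMeasureCandidate Q) :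
    SigmaFinite Q := by
  let A : ℤ × ℕ → Set (ℤ → ℝ) := fun p => {x | 1 / ((p.2 : ℝ) + 1) ≤ min (x p.1 ^ 2) 1}
  refine Measure.sigmaFinite_of_countable (S := insert {0} (Set.range A))
    ((Set.countable_range A).insert _) ?_ ?_
  · rintro _ (rfl | ⟨p, rfl⟩)
    · simp [hQ.zero_path]
    · exact (hQ.integrable_min p.1).measure_ge_lt_top (by positivity)
  · refine Set.eq_univ_of_forall fun x => ?_
    by_cases hx : x = 0
    · exact ⟨{0}, Set.mem_insert _ _, hx⟩
    · obtain ⟨k, hk⟩ := Function.ne_iff.1 hx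
      have hpos : 0 < min (x k ^ 2) 1 := lt_min (sq_pos_of_ne_zero hk) one_pos
      obtain ⟨n, hn⟩ := exists_nat_one_div_lt hpos
      exact ⟨A (k, n), Set.mem_insert_of_mem _ ⟨_, rfl⟩, hn.le⟩

lemma pathCharFun_zero (ν : Measure (ℤ → ℝ)) : pathCharFun ν 0 = ν.real Set.univ := by
  simp [pathCharFun]

lemma continuous_pathCharFun_single (ν : Measure (ℤ → ℝ)) [IsFiniteMeasure ν] (k : ℤ) :
    Continuous fun t : ℝ => pathCharFun ν (Finsupp.single k t) := by
  simp only [← charFun_map_eval]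
  fun_prop

/-- The mixture of the zero path with `n⁻¹ ν`. -/
def smallJumpLaw (ν : Measure (ℤ → ℝ)) (n : ℕ) : Measure (ℤ → ℝ) :=
  (1 - ν.real Set.univ / n).toNNReal • Measure.dirac 0 + ((n : ℝ≥0)⁻¹) • ν

lemma pathCharFun_smallJumpLaw (ν : Measure (ℤ → ℝ)) [IsFiniteMeasure ν] {n : ℕ}
    (hn : ν.real Set.univ ≤ n) (a : ℤ →₀ ℝ) :
    pathCharFun (smallJumpLaw ν n) a = 1 + (pathCharFun ν a - ν.real Set.univ) / n := by
  have h : 0 ≤ 1 - ν.real Set.univ / n := sub_nonneg.2 (div_le_one_of_le₀ hn (Nat.cast_nonneg n))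
  have h' : (((1 - ν.real Set.univ / n).toNNReal : ℝ) : ℂ) = ((1 - ν.real Set.univ / n : ℝ) : ℂ) := by
    rw [Real.coe_toNNReal _ h]
  rw [smallJumpLaw, pathCharFun_add_measure, pathCharFun_smul_measure, pathCharFun_smul_measure,
    pathCharFun_dirac, character_zero_right,
    show (((1 - ν.real Set.univ / n).toNNReal : ℂ))
      = (((1 - ν.real Set.univ / n).toNNReal : ℝ) : ℂ) from rfl, h']
  push_cast
  ring

lemma isProbabilityMeasure_smallJumpLaw (ν : Measure (ℤ → ℝ)) [IsFiniteMeasure ν] {n : ℕ}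
    (hn : ν.real Set.univ ≤ n) : IsProbabilityMeasure (smallJumpLaw ν n) := by
  have : IsFiniteMeasure (smallJumpLaw ν n) := by unfold smallJumpLaw; infer_instance
  have h := pathCharFun_smallJumpLaw ν hn 0
  rw [pathCharFun_zero, pathCharFun_zero, sub_self, zero_div, add_zero] at h
  rw [isProbabilityMeasure_iff_real]
  exact_mod_cast h

/-- Existence of compound Poisson distributions on the path space. -/
lemma exists_compoundPoisson (ν : Measure (ℤ → ℝ)) [IsFiniteMeasure ν] :
    ∃ P : Measure (ℤ → ℝ), IsProbabilityMeasure P ∧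
      ∀ a, pathCharFun P a = Complex.exp (pathCharFun ν a - ν.real Set.univ) := by
  obtain ⟨m, hm⟩ := exists_nat_ge (ν.real Set.univ)
  -- Shifting the index by `m` keeps the weight of the zero path nonnegative; the `n`-th powers of
  -- `1 + z / n` then tend to `exp z`.
  have hn (n : ℕ) : ν.real Set.univ ≤ (n + m : ℕ) := by
    refine hm.trans ?_
    exact_mod_cast Nat.le_add_left m n
  have (n : ℕ) := isProbabilityMeasure_smallJumpLaw ν (hn n)
  refine exists_of_tendsto_pathCharFun
    (μ := fun n => sumLaw (n + m) (smallJumpLaw ν (n + m))) (fun a => ?_) fun k => ?_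
  · simp only [pathCharFun_sumLaw, pathCharFun_smallJumpLaw ν (hn _)]
    exact (Complex.tendsto_one_add_div_pow_exp _).comp (tendsto_add_atTop_nat m)
  · exact (Complex.continuous_exp.comp
      ((continuous_pathCharFun_single ν k).sub continuous_const)).continuousAt

/-- For a finite measure the compensator is integrable by itself, so it amounts to the drift `-m`: a
compound Poisson law translated by `b - m` works. -/
lemma exists_pathCharFun_eq_of_isFiniteMeasure (b : ℤ → ℝ) (ν : Measure (ℤ → ℝ))
    [IsFiniteMeasure ν] : ∃ P : Measure (ℤ → ℝ), IsProbabilityMeasure P ∧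
      ∀ a, pathCharFun P a = Complex.exp (levyExponent 0 b ν a) := by
  obtain ⟨P, hP, hPc⟩ := exists_compoundPoisson ν
  let m : ℤ → ℝ := fun k => ∫ x, trunc (x k) ∂ν
  have htr (k : ℤ) : Integrable (fun x : ℤ → ℝ => truncPath x k) ν :=
    (integrable_const (1 : ℝ)).mono'
      (continuous_trunc.comp (continuous_apply k)).aestronglyMeasurable
      (ae_of_all _ fun x => abs_trunc_le _)
  have hpair (a : ℤ →₀ ℝ) : Integrable (fun x => pairing a (truncPath x)) ν := by
    simp only [pairing_eq_sum]
    exact integrable_finsetSum _ fun k _ => (htr k).const_mul _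
  have hm (a : ℤ →₀ ℝ) : ∫ x, pairing a (truncPath x) ∂ν = pairing a m := by
    simp only [pairing_eq_sum]
    rw [integral_finsetSum _ fun k _ => (htr k).const_mul _]
    exact Finset.sum_congr rfl fun k _ => integral_const_mul _ _
  refine ⟨P ∗ Measure.dirac (b + (-1 : ℝ) • m), inferInstance, fun a => ?_⟩
  rw [pathCharFun_conv, hPc, pathCharFun_dirac, character, ← Complex.exp_add, levyExponent_eq]
  congr 1
  simp only [levyIntegrand]
  have hsub : Integrable (fun x => character a x - 1) ν :=
    (integrable_character a ν).sub (integrable_const 1)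
  have hI : Integrable (fun x => Complex.I * (pairing a (truncPath x) : ℂ)) ν :=
    (hpair a).ofReal.const_mul _
  rw [integral_sub hsub hI, integral_sub (integrable_character a ν) (integrable_const 1),
    integral_const_mul, integral_complex_ofReal, hm, pairing_add_right, pairing_smul_right]
  simp [pathCharFun]
  ring

/-- Exhaust `Q` by restrictions to sets of finite measure: the exponents converge, and the limit is
continuous along rays. -/
lemma IsLevyMeasureCandidate.exists_pathCharFun_eq {Q : Measure (ℤ → ℝ)}
    (hQ : IsLevyMeasureCandidate Q) (b : ℤ → ℝ) :
    ∃ P : Measure (ℤ → ℝ), IsProbabilityMeasure P ∧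
      ∀ a, pathCharFun P a = Complex.exp (levyExponent 0 b Q a) := by
  have := hQ.sigmaFinite
  have hfin (n : ℕ) : IsFiniteMeasure (Q.restrict (spanningSets Q n)) :=
    ⟨by simpa using measure_spanningSets_lt_top Q n⟩
  choose P hP hPc using fun n =>
    exists_pathCharFun_eq_of_isFiniteMeasure b (Q.restrict (spanningSets Q n))
  refine exists_of_tendsto_pathCharFun (μ := P) (fun a => ?_) fun k => ?_
  · simp only [hPc, levyExponent_eq]
    refine (Complex.continuous_exp.tendsto _).comp (tendsto_const_nhds.add ?_)
    have := tendsto_setIntegral_of_monotone (μ := Q) (f := levyIntegrand a)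
      (measurableSet_spanningSets Q) (monotone_spanningSets Q)
      (hQ.integrable_levyIntegrand a).integrableOn
    rwa [iUnion_spanningSets, setIntegral_univ] at this
  · have := continuous_levyExponent_smul 0 b hQ (Finsupp.single k 1)
    simp only [Finsupp.smul_single, smul_eq_mul, mul_one] at this
    exact (Complex.continuous_exp.comp this).continuousAt

lemma levyExponent_smul (c : ℝ≥0) (b : ℤ → ℝ) (Q : Measure (ℤ → ℝ)) (a : ℤ →₀ ℝ) :
    levyExponent 0 ((c : ℝ) • b) (c • Q) a = c * levyExponent 0 b Q a := by
  rw [levyExponent_eq, levyExponent_eq, integral_smul_nnreal_measure, pairing_smul_right,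
    NNReal.smul_def, Complex.real_smul]
  simp
  ring

/-- Existence of an infinitely divisible process with a given drift and Lévy measure. -/
theorem IsLevyMeasureCandidate.exists_hasLevyTriplet {Q : Measure (ℤ → ℝ)}
    (hQ : IsLevyMeasureCandidate Q) (b : ℤ → ℝ) :
    ∃ P : Measure (ℤ → ℝ), IsProbabilityMeasure P ∧ IsInfinitelyDivisible P ∧
      HasLevyTriplet P 0 b Q := by
  obtain ⟨P, hP, hPc⟩ := hQ.exists_pathCharFun_eq b
  refine ⟨P, hP, fun n hn => ?_, Matrix.PosSemidef.zero, hQ.zero_path, hQ.lintegral_lt_top, hPc⟩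
  -- The convolution root of order `n` has drift `b / n` and Lévy measure `Q / n`.
  obtain ⟨ν, hν, hνc⟩ :=
    (hQ.smul ((n : ℝ≥0)⁻¹)).exists_pathCharFun_eq (((n : ℝ≥0)⁻¹ : ℝ≥0) • b : ℤ → ℝ)
  refine ⟨ν, hν, ?_⟩
  change P = sumLaw n ν
  refine ext_of_pathCharFun fun a => ?_
  have hn0 : (n : ℂ) ≠ 0 := by exact_mod_cast (by omega : n ≠ 0)
  rw [pathCharFun_sumLaw, hPc, hνc, ← Complex.exp_nat_mul, NNReal.smul_def, levyExponent_smul]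
  congr 1
  push_cast
  field_simp

/-! ### The shift acting on triplets, and stationarity -/

@[fun_prop]
lemma measurable_shift : Measurable shift := by unfold shift; fun_prop

/-- The shift as a measurable equivalence. -/
def shiftEquiv : (ℤ → ℝ) ≃ᵐ (ℤ → ℝ) where
  toFun := shift
  invFun x n := x (n - 1)
  left_inv x := by ext n; simp [shift]
  right_inv x := by ext n; simp [shift]
  measurable_toFun := measurable_shift
  measurable_invFun := measurable_pi_lambda _ fun n => measurable_pi_apply (n - 1)

/-- The action of the shift on coefficients. -/
def shiftCoeff (a : ℤ →₀ ℝ) : ℤ →₀ ℝ := a.mapDomain (· + 1)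

lemma pairing_shift (a : ℤ →₀ ℝ) (x : ℤ → ℝ) : pairing a (shift x) = pairing (shiftCoeff a) x := by
  rw [pairing, pairing, shiftCoeff, Finsupp.sum_mapDomain_index (by simp) (by simp [add_mul])]
  rfl

/-- The covariance of the shifted process. -/
def shiftCov (Γ : Matrix ℤ ℤ ℝ) : Matrix ℤ ℤ ℝ := Γ.submatrix (· + 1) (· + 1)

lemma covForm_shiftCov (Γ : Matrix ℤ ℤ ℝ) (a : ℤ →₀ ℝ) :
    covForm (shiftCov Γ) a a = covForm Γ (shiftCoeff a) (shiftCoeff a) := by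
  have : (fun j => pairing a (shiftCov Γ j)) = shift fun j => pairing (shiftCoeff a) (Γ j) := by
    ext j
    rw [shift, ← pairing_shift]
    rfl
  rw [covForm, this, pairing_shift, covForm]

/-- Truncation acts coordinatewise and so commutes with the shift; shifting a process therefore
creates no extra drift. -/
lemma levyIntegrand_shift (a : ℤ →₀ ℝ) (x : ℤ → ℝ) :
    levyIntegrand a (shift x) = levyIntegrand (shiftCoeff a) x := by
  rw [levyIntegrand, character, pairing_shift]
  change _ - 1 - Complex.I * ((pairing a (shift (truncPath x)) : ℝ) : ℂ) = _
  rw [pairing_shift]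
  rfl

lemma levyExponent_map_shift (Γ : Matrix ℤ ℤ ℝ) (b : ℤ → ℝ) (Q : Measure (ℤ → ℝ)) (a : ℤ →₀ ℝ) :
    levyExponent (shiftCov Γ) (shift b) (Q.map shift) a = levyExponent Γ b Q (shiftCoeff a) := by
  rw [levyExponent_eq, levyExponent_eq, pairing_shift, covForm_shiftCov,
    integral_map measurable_shift.aemeasurable (continuous_levyIntegrand a).aestronglyMeasurable]
  simp only [levyIntegrand_shift]

lemma pathCharFun_map_shift (P : Measure (ℤ → ℝ)) (a : ℤ →₀ ℝ) :
    pathCharFun (P.map shift) a = pathCharFun P (shiftCoeff a) := by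
  rw [pathCharFun_map measurable_shift]
  simp only [character, pairing_shift, pathCharFun]

lemma IsLevyMeasureCandidate.map_shift {Q : Measure (ℤ → ℝ)} (hQ : IsLevyMeasureCandidate Q) :
    IsLevyMeasureCandidate (Q.map shift) where
  zero_path := by
    rw [Measure.map_apply measurable_shift (measurableSet_singleton _)]
    convert hQ.zero_path using 2
    ext x
    change shiftEquiv x = 0 ↔ x = 0
    rw [show (0 : ℤ → ℝ) = shiftEquiv 0 from rfl, shiftEquiv.injective.eq_iff]
    rfl
  lintegral_lt_top k := by
    rw [lintegral_map (by fun_prop) measurable_shift]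
    exact hQ.lintegral_lt_top (k + 1)

lemma HasLevyTriplet.pathCharFun_eq {P Q : Measure (ℤ → ℝ)} {Γ : Matrix ℤ ℤ ℝ} {b : ℤ → ℝ}
    (h : HasLevyTriplet P Γ b Q) (a : ℤ →₀ ℝ) :
    pathCharFun P a = Complex.exp (levyExponent Γ b Q a) := h.charFun_eq a

lemma HasLevyTriplet.exp_levyExponent_shift {P Q : Measure (ℤ → ℝ)} {Γ : Matrix ℤ ℤ ℝ} {b : ℤ → ℝ}
    (h : HasLevyTriplet P Γ b Q) (hP : IsStationary P) (a : ℤ →₀ ℝ) :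
    Complex.exp (levyExponent (shiftCov Γ) (shift b) (Q.map shift) a)
      = Complex.exp (levyExponent Γ b Q a) := by
  rw [levyExponent_map_shift, ← h.pathCharFun_eq, ← h.pathCharFun_eq, ← pathCharFun_map_shift,
    hP.map_eq]

/-- The Lévy measure of a stationary process is invariant under the shift. -/
theorem HasLevyTriplet.measurePreserving {P Q : Measure (ℤ → ℝ)} {Γ : Matrix ℤ ℤ ℝ} {b : ℤ → ℝ}
    (h : HasLevyTriplet P Γ b Q) (hP : IsStationary P) : MeasurePreserving shift Q Q :=
  ⟨measurable_shift, levyMeasure_unique (h.gaussian_posSemidef.submatrix _) h.gaussian_posSemidef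
    h.isLevyMeasureCandidate.map_shift h.isLevyMeasureCandidate (h.exp_levyExponent_shift hP)⟩

/-- The drift of a stationary process without Gaussian part is invariant under the shift. -/
lemma HasLevyTriplet.shift_drift {P Q : Measure (ℤ → ℝ)} {b : ℤ → ℝ}
    (h : HasLevyTriplet P 0 b Q) (hP : IsStationary P) : shift b = b := by
  have hQ := h.isLevyMeasureCandidate
  ext k
  have := levyExponent_eq_of_exp_eq hQ.map_shift hQ (h.exp_levyExponent_shift hP)
    (Finsupp.single k 1)
  -- As `Q` is invariant the two integrals agree, and at the coefficient `single k 1` only `b (k +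
  -- 1) = b k` remains.
  rw [(h.measurePreserving hP).map_eq, levyExponent_eq, levyExponent_eq,
    show shiftCov 0 = 0 from rfl] at this
  simpa using this

/-- A process whose Lévy–Khintchine triplet is invariant under the shift is stationary. -/
lemma HasLevyTriplet.isStationary {P Q : Measure (ℤ → ℝ)} [IsProbabilityMeasure P] {b : ℤ → ℝ}
    (h : HasLevyTriplet P 0 b Q) (hQ : MeasurePreserving shift Q Q) (hb : shift b = b) :
    IsStationary P := by
  refine ⟨measurable_shift, ?_⟩
  have : IsProbabilityMeasure (P.map shift) :=
    Measure.isProbabilityMeasure_map measurable_shift.aemeasurable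
  refine ext_of_pathCharFun fun a => ?_
  have := levyExponent_map_shift 0 b Q a
  rw [hQ.map_eq, hb, show shiftCov 0 = 0 from rfl] at this
  rw [pathCharFun_map_shift, h.pathCharFun_eq, h.pathCharFun_eq, this]

/-! ### Purity and ergodicity -/

/-- A shift-invariant measure bounded by an ergodic one is a multiple of it. -/
lemma exists_eq_smul_of_ergodic {Q Q₁ Q₂ : Measure (ℤ → ℝ)} [SigmaFinite Q]
    (hQ : Ergodic shift Q) (hQ₁ : MeasurePreserving shift Q₁ Q₁) (hadd : Q₁ + Q₂ = Q) :
    ∃ c : ℝ≥0, c ≤ 1 ∧ Q₁ = c • Q ∧ Q₂ = (1 - c) • Q := by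
  have hle : Q₁ ≤ Q := hadd ▸ Measure.le_add_right le_rfl
  have : SigmaFinite Q₁ := Measure.sigmaFinite_of_le Q hle
  have hac : Q₁ ≪ Q := hle.absolutelyContinuous
  set f := Q₁.rnDeriv Q
  have hf : Measurable f := Measure.measurable_rnDeriv Q₁ Q
  have hfQ : Q.withDensity f = Q₁ := Measure.withDensity_rnDeriv_eq Q₁ Q hac
  have hfS : f ∘ shift =ᵐ[Q] f := by
    rw [← withDensity_eq_iff_of_sigmaFinite (hf.comp measurable_shift).aemeasurable hf.aemeasurable]
    -- Compare after pushing forward by the invertible shift: since `Q` is invariant, the image of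
    -- the measure with density `f ∘ shift` has density `f`, so it is `Q₁`, as is the image of `Q₁`.
    refine shiftEquiv.map_measurableEquiv_injective ?_
    change (Q.withDensity (f ∘ shift)).map shift = (Q.withDensity f).map shift
    rw [hfQ, hQ₁.map_eq]
    ext s hs
    rw [Measure.map_apply measurable_shift hs, withDensity_apply _ (measurable_shift hs)]
    refine (hQ.toMeasurePreserving.setLIntegral_comp_preimage hs hf).trans ?_
    rw [← withDensity_apply _ hs, hfQ]
  obtain ⟨c, hc⟩ := hQ.ae_eq_const_of_ae_eq_comp₀ hf.nullMeasurable hfS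
  -- When `Q = 0` the constant `c` is arbitrary, possibly infinite; capping it at 1 covers this case
  -- too.
  have hc1 : f =ᵐ[Q] fun _ => min c 1 := by
    filter_upwards [hc, Measure.rnDeriv_le_one_of_le hle] with x hx hx1
    have hx' : f x = c := hx
    have hx1' : f x ≤ 1 := hx1
    rw [← hx', min_eq_left hx1']
  have hne : min c 1 ≠ ∞ := ((min_le_right c 1).trans_lt ENNReal.one_lt_top).ne
  have h1 : Q₁ = (min c 1).toNNReal • Q := by
    rw [← hfQ, withDensity_congr_ae hc1, withDensity_const]
    conv_lhs => rw [← ENNReal.coe_toNNReal hne]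
    rfl
  have hle1 : (min c 1).toNNReal ≤ 1 :=
    ENNReal.toNNReal_mono ENNReal.one_ne_top (min_le_right c 1)
  refine ⟨_, hle1, h1, ?_⟩
  rw [← Measure.add_right_inj Q₁, hadd]
  conv_rhs => rw [h1]
  rw [← add_smul, add_tsub_cancel_of_le hle1, one_smul]

lemma law_add {Ω : Type*} [MeasurableSpace Ω] {μ : Measure Ω} [IsProbabilityMeasure μ]
    {X₁ X₂ : ℤ → Ω → ℝ} (h₁ : ∀ n, Measurable (X₁ n)) (h₂ : ∀ n, Measurable (X₂ n))
    (h : IndepFun (fun ω n => X₁ n ω) (fun ω n => X₂ n ω) μ) :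
    law (X₁ + X₂) μ = law X₁ μ ∗ law X₂ μ :=
  h.map_add_eq_map_conv_map (measurable_pi_lambda _ h₁) (measurable_pi_lambda _ h₂)

lemma isProbabilityMeasure_law {Ω : Type*} [MeasurableSpace Ω] {μ : Measure Ω}
    [IsProbabilityMeasure μ] {X : ℤ → Ω → ℝ} (h : ∀ n, Measurable (X n)) :
    IsProbabilityMeasure (law X μ) :=
  Measure.isProbabilityMeasure_map (measurable_pi_lambda _ h).aemeasurable

/-- The summands may a priori have Gaussian parts; uniqueness of the Lévy measure holds for
arbitrary covariances, so these need not be excluded. -/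
theorem isPure_of_ergodic {P Q : Measure (ℤ → ℝ)} (hQ : IsIDpWithLevyMeasure P Q)
    (herg : Ergodic shift Q) : IsPure P Q := by
  obtain ⟨-, b, hb⟩ := hQ
  intro Ω _ μ _ X₁ X₂ Q₁ Q₂ hX₁ hX₂ hind hs₁ hs₂ hQ₁ hQ₂ hlaw
  obtain ⟨-, Γ₁, b₁, ht₁⟩ := hQ₁
  obtain ⟨-, Γ₂, b₂, ht₂⟩ := hQ₂
  have := isProbabilityMeasure_law (μ := μ) hX₁
  have := isProbabilityMeasure_law (μ := μ) hX₂
  have hc₁ := ht₁.isLevyMeasureCandidate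
  have hc₂ := ht₂.isLevyMeasureCandidate
  have hadd : Q₁ + Q₂ = Q := by
    refine levyMeasure_unique (b := b₁ + b₂) (b' := b)
      (ht₁.gaussian_posSemidef.add ht₂.gaussian_posSemidef) hb.gaussian_posSemidef
      (hc₁.add hc₂) hb.isLevyMeasureCandidate fun a => ?_
    rw [levyExponent_add _ _ _ _ hc₁ hc₂, Complex.exp_add, ← ht₁.pathCharFun_eq,
      ← ht₂.pathCharFun_eq, ← hb.pathCharFun_eq, ← hlaw, law_add hX₁ hX₂ hind, pathCharFun_conv]
  have := hb.isLevyMeasureCandidate.sigmaFinite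
  exact exists_eq_smul_of_ergodic herg (ht₁.measurePreserving hs₁) hadd

theorem ergodic_of_isPure {P Q : Measure (ℤ → ℝ)} [IsProbabilityMeasure P] (hP : IsStationary P)
    (hQ : IsIDpWithLevyMeasure P Q) (hpure : IsPure P Q) : Ergodic shift Q := by
  obtain ⟨-, b, hb⟩ := hQ
  have hmp := hb.measurePreserving hP
  refine ⟨hmp, ⟨fun A hA hAS => ?_⟩⟩
  have hres {B : Set (ℤ → ℝ)} (hB : MeasurableSet B) (hBS : shift ⁻¹' B = B) :
      MeasurePreserving shift (Q.restrict B) (Q.restrict B) := by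
    simpa only [hBS] using hmp.restrict_preimage hB
  have hcQ := hb.isLevyMeasureCandidate
  have hc₁ : IsLevyMeasureCandidate (Q.restrict A) := hcQ.mono Measure.restrict_le_self
  have hc₂ : IsLevyMeasureCandidate (Q.restrict Aᶜ) := hcQ.mono Measure.restrict_le_self
  obtain ⟨P₁, hP₁, hid₁, ht₁⟩ := hc₁.exists_hasLevyTriplet 0
  -- The whole drift goes to the second process; both `0` and `b` are shift-invariant, so both laws
  -- are stationary.
  obtain ⟨P₂, hP₂, hid₂, ht₂⟩ := hc₂.exists_hasLevyTriplet b
  have hs₁ : IsStationary P₁ := ht₁.isStationary (hres hA hAS) rfl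
  have hs₂ : IsStationary P₂ := ht₂.isStationary
    (hres hA.compl (by rw [Set.preimage_compl, hAS])) (hb.shift_drift hP)
  let X₁ : ℤ → (ℤ → ℝ) × (ℤ → ℝ) → ℝ := fun n ω => ω.1 n
  let X₂ : ℤ → (ℤ → ℝ) × (ℤ → ℝ) → ℝ := fun n ω => ω.2 n
  have hX₁ (n : ℤ) : Measurable (X₁ n) := (measurable_pi_apply n).comp measurable_fst
  have hX₂ (n : ℤ) : Measurable (X₂ n) := (measurable_pi_apply n).comp measurable_snd
  have hl₁ : law X₁ (P₁.prod P₂) = P₁ := measurePreserving_fst.map_eq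
  have hl₂ : law X₂ (P₁.prod P₂) = P₂ := measurePreserving_snd.map_eq
  have hind : IndepFun (fun ω n => X₁ n ω) (fun ω n => X₂ n ω) (P₁.prod P₂) :=
    indepFun_prod measurable_id measurable_id
  have hlaw : law (X₁ + X₂) (P₁.prod P₂) = P := by
    rw [law_add hX₁ hX₂ hind, hl₁, hl₂]
    refine ext_of_pathCharFun fun a => ?_
    rw [pathCharFun_conv, ht₁.pathCharFun_eq, ht₂.pathCharFun_eq, hb.pathCharFun_eq,
      ← Complex.exp_add, ← levyExponent_add _ _ _ _ hc₁ hc₂, add_zero, zero_add,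
      Measure.restrict_add_restrict_compl hA]
  obtain ⟨c, -, hQ₁, -⟩ := hpure _ _ (P₁.prod P₂) inferInstance X₁ X₂ (Q.restrict A)
    (Q.restrict Aᶜ) hX₁ hX₂ hind (hl₁.symm ▸ hs₁) (hl₂.symm ▸ hs₂)
    (hl₁.symm ▸ ⟨hid₁, 0, 0, ht₁⟩) (hl₂.symm ▸ ⟨hid₂, 0, b, ht₂⟩) hlaw
  rw [eventuallyConst_set']
  -- Evaluating `Q.restrict A = c • Q` on `Aᶜ` gives `0 = c * Q Aᶜ`: either `c = 0` and `A` is null,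
  -- or `Aᶜ` is null.
  have hAc := congrArg (fun ν => ν Aᶜ) hQ₁
  simp only [Measure.restrict_apply hA.compl, Set.compl_inter_self, measure_empty,
    Measure.smul_apply] at hAc
  rcases eq_or_ne c 0 with rfl | hc
  · left
    rw [ae_eq_empty, ← Measure.restrict_eq_zero, hQ₁, zero_smul]
  · right
    rw [ae_eq_univ]
    simpa [hc, ENNReal.smul_def, eq_comm] using hAc

end IDProcess

end

theorem mainTheorem8 {Ω : Type*} [MeasurableSpace Ω] (μ : Measure Ω) [IsProbabilityMeasure μ]
    (X : ℤ → Ω → ℝ) (hX : ∀ n, Measurable (X n))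
    (hstat : IDProcess.IsStationary (IDProcess.law X μ))
    (Q : Measure (ℤ → ℝ)) (hQ : IDProcess.IsIDpWithLevyMeasure (IDProcess.law X μ) Q) :
    IDProcess.IsPure (IDProcess.law X μ) Q ↔ Ergodic IDProcess.shift Q := by
  have := IDProcess.isProbabilityMeasure_law (μ := μ) hX
  exact ⟨IDProcess.ergodic_of_isPure hstat hQ, IDProcess.isPure_of_ergodic hQ⟩
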